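/- Let $M$ be a smooth $3$-manifold with a contact structure $\xi$, that is, a field of tangent planes $\xi \subset TM$ such that every point of $M$ has an open neighbourhood $U$ with a smooth $1$-form $\alpha$ on $U$ satisfying $\xi|_U = \ker\alpha$ and $\alpha\wedge d\alpha \neq 0$ everywhere on $U$. A smooth map $\eta : N \to M$ from a $1$-manifold $N$ is called a Legendrian curve if $\eta^*\alpha = 0$ for all such local $1$-forms $\alpha$, i.e. if $d\eta_t(T_tN) \subset \xi_{\eta(t)}$ for every $t \in N$ ($\eta$ is not required to be an immersion). Let $N$ be a compact interval $[a,b]$ with $a<b$, or the circle $S^1$. Equip the set $C^0(N,M)$ of continuous maps with the $C^0$-Whitney topology, generated by the sets $\{f : \operatorname{graph}(f) \subset W\}$ with $W \subset N \times M$ open. Theorem. For every continuous map $\upsilon : N \to M$, every open neighbourhood of $\upsilon$ in $C^0(N,M)$ contains a smooth Legendrian curve $\eta : N \to M$. -/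

import Mathlib

open scoped Manifold ContDiff Topology

noncomputable section

/-- The model space `ℝ³`. -/
abbrev E3 : Type := EuclideanSpace ℝ (Fin 3)

/-- A covector on `ℝ³`, regarded as an alternating `1`-form. -/
def toOneForm (l : E3 →L[ℝ] ℝ) : E3 [⋀^Fin 1]→L[ℝ] ℝ :=
  ContinuousAlternatingMap.ofSubsingleton ℝ E3 ℝ (0 : Fin 1) l

/-- The exterior derivative `dα` of a `1`-form `α` on (an open subset of) `ℝ³`. -/
def dOneForm (α : E3 → E3 →L[ℝ] ℝ) (x : E3) : E3 [⋀^Fin 2]→L[ℝ] ℝ :=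
  extDeriv (fun y => toOneForm (α y)) x

/-- The value `(α ∧ dα)_x(u, v, w)`, for a `1`-form `α` on (an open subset of) `ℝ³`. -/
def wedgeD (α : E3 → E3 →L[ℝ] ℝ) (x u v w : E3) : ℝ :=
  α x u * dOneForm α x ![v, w] - α x v * dOneForm α x ![u, w] + α x w * dOneForm α x ![u, v]

/-- The formula `dα(v, w) = (D_v α)(w) - (D_w α)(v)`. -/
theorem dOneForm_apply (α : E3 → E3 →L[ℝ] ℝ) (x v w : E3) (h : DifferentiableAt ℝ α x) :
    dOneForm α x ![v, w] = fderiv ℝ α x v w - fderiv ℝ α x w v := by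
  have h1 : DifferentiableAt ℝ (fun y => toOneForm (α y)) x :=
    (ContinuousAlternatingMap.ofSubsingletonLIE (𝕜 := ℝ) (E := E3) (F := ℝ)
      (0 : Fin 1)).differentiable.differentiableAt.comp x h
  unfold dOneForm
  rw [extDeriv_apply h1]
  have h2 : ∀ u t : E3, fderiv ℝ (fun y => α y u) x t = fderiv ℝ α x t u := by
    intro u t
    rw [fderiv_clm_apply h (differentiableAt_const u)]
    simp
  simp [Fin.sum_univ_two, toOneForm, Fin.removeNth, h2, sub_eq_add_neg]

section Contact

variable {M : Type*} [TopologicalSpace M] [ChartedSpace E3 M]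

/-- The pull-back `φ^*α` of a `1`-form `α` on `ℝ³` by the preferred chart `φ` of `M` at `p`,
evaluated at the point `q` (in the domain of `φ`). -/
def chartPullback (p : M) (α : E3 → E3 →L[ℝ] ℝ) (q : M) : TangentSpace (𝓡 3) q →L[ℝ] ℝ :=
  (α (extChartAt (𝓡 3) p q)).comp (mfderiv (𝓡 3) 𝓘(ℝ, E3) (extChartAt (𝓡 3) p) q)

/-- Let `φ` be the preferred chart of `M` at `p`. The `1`-form `φ^*α` is a smooth contact form
on the open neighbourhood `φ⁻¹(V)` of `p`, with kernel the field of tangent subspaces `ξ`. -/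
structure IsLocalContactForm (ξ : ∀ q : M, Submodule ℝ (TangentSpace (𝓡 3) q)) (p : M)
    (V : Set E3) (α : E3 → E3 →L[ℝ] ℝ) : Prop where
  isOpen : IsOpen V
  mem : extChartAt (𝓡 3) p p ∈ V
  subset_target : V ⊆ (extChartAt (𝓡 3) p).target
  smooth : ContDiffOn ℝ ∞ α V
  ker_eq : ∀ q ∈ (extChartAt (𝓡 3) p).source, extChartAt (𝓡 3) p q ∈ V →
    ξ q = (chartPullback p α q).ker
  wedge_ne_zero : ∀ x ∈ V, ∃ u v w : E3, wedgeD α x u v w ≠ 0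

variable (M) in
/-- A contact structure on a `3`-manifold `M`: a field `ξ` of subspaces of the tangent spaces
which near every point is the kernel of a smooth `1`-form `α` with `α ∧ dα` nowhere zero.
(In particular `α` has no zeros, so `ξ` is a smooth subbundle of rank `2`.) -/
structure ContactStructure where
  plane : ∀ q : M, Submodule ℝ (TangentSpace (𝓡 3) q)
  exists_form : ∀ p : M, ∃ (V : Set E3) (α : E3 → E3 →L[ℝ] ℝ), IsLocalContactForm plane p V α

/-- A smooth map `η` from a manifold `N` to `M` is Legendrian if it is everywhere tangent to `ξ`,
i.e. `η^*α = 0` for the local `1`-forms `α` with kernel `ξ`. -/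
structure ContactStructure.IsLegendrian (ξ : ContactStructure M)
    {E H N : Type*} [NormedAddCommGroup E] [NormedSpace ℝ E] [TopologicalSpace H]
    (J : ModelWithCorners ℝ E H) [TopologicalSpace N] [ChartedSpace H N] (η : N → M) : Prop where
  smooth : ContMDiff J (𝓡 3) ∞ η
  tangent : ∀ (t : N) (v : TangentSpace J t), mfderiv J (𝓡 3) η t v ∈ ξ.plane (η t)

end Contact

/-- The Whitney (strong) `C⁰`-topology on the continuous maps `N → M`: it is generated by the sets
of all maps whose graph is contained in `W`, for `W` open in `N × M`. -/
abbrev whitneyC0 (N M : Type*) [TopologicalSpace N] [TopologicalSpace M] :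
    TopologicalSpace C(N, M) :=
  TopologicalSpace.generateFrom
    {S | ∃ W : Set (N × M), IsOpen W ∧ S = {f : C(N, M) | ∀ t : N, (t, f t) ∈ W}}

end

/-! A contact plane field is so far from integrable that Legendrian paths from a point x fill a
neighbourhood of x. In affine coordinates (u, v, z) with u, v along the plane at x, the field is z'
= A u' + B v' with A = B = 0 at the origin, and the contact condition there says κ = ∂B/∂u - ∂A/∂v ≠
0. Lifting a planar curve means solving an ODE for z, and by Green's formula a small loop changes z
by about κ times its signed area. The planar curve prescribes the final (u, v); varying the area of
an added loop between opposite signs makes the final z cross the required height. Continuous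
dependence of the flow and the intermediate value theorem therefore suffice
(`eventually_exists_lift`), with no derivative of the endpoint map.

Paths slowed down to rest at their ends concatenate smoothly; this uses that Legendrian curves need
not be immersed. Reachability in a connected open set is then an equivalence relation with open
classes, so any two points of a chart ball are joined inside it (`exists_isHorizontalPath`).
Finally, a Lebesgue number for N allows the values of υ at nearby nodes to be joined by Legendrian
paths in small sets, which keeps the graph in W (`ContactStructure.exists_legendrian_approx`). The
interval and the circle are both treated through a uniformly continuous parametrization ℝ → N. -/

/-! ### Flows with continuous dependence and a confinement bound -/

open Set Metric ODE in
/-- A local flow which is continuous in the initial point and stays in the ball in which the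
vector field is controlled. -/
theorem IsPicardLindelof.exists_continuousOn_flow_mem_closedBall
    {E : Type*} [NormedAddCommGroup E] [NormedSpace ℝ E] [CompleteSpace E]
    {f : ℝ → E → E} {tmin tmax : ℝ} {t₀ : Icc tmin tmax} {x₀ : E} {a r L K : NNReal}
    (hf : IsPicardLindelof f t₀ x₀ a r L K) :
    ∃ φ : E → ℝ → E, (∀ x ∈ closedBall x₀ r, φ x t₀ = x ∧
      ∀ t ∈ Icc tmin tmax, φ x t ∈ closedBall x₀ a ∧
        HasDerivWithinAt (φ x) (f t (φ x t)) (Icc tmin tmax) t) ∧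
      ∀ t ∈ Icc tmin tmax, ContinuousOn (φ · t) (closedBall x₀ r) := by
  classical
  have (x) (hx : x ∈ closedBall x₀ r) := FunSpace.exists_isFixedPt_next hf hx
  choose φ hφ using this
  set φ' := fun (x : E) ↦ if hx : x ∈ closedBall x₀ r then
    φ x hx |>.compProj else 0 with hφ'
  refine ⟨φ', fun x hx ↦ ⟨?_, fun t ht ↦ ⟨?_, ?_⟩⟩, ?_⟩
  · rw [hφ']
    beta_reduce
    rw [dif_pos hx, FunSpace.compProj_val, ← hφ, FunSpace.next_apply₀]
  · rw [hφ']
    beta_reduce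
    rw [dif_pos hx]
    exact (φ x hx).compProj_mem_closedBall hf.mul_max_le
  · rw [hφ']
    beta_reduce
    rw [dif_pos hx, FunSpace.compProj_apply]
    apply hasDerivWithinAt_picard_Icc t₀.2 hf.continuousOn_uncurry
      (φ x hx |>.continuous_compProj.continuousOn)
      (fun _ ht' ↦ φ x hx |>.compProj_mem_closedBall hf.mul_max_le)
      x ht |>.congr_of_mem _ ht
    intro t' ht'
    nth_rw 1 [← hφ]
    rw [FunSpace.compProj_of_mem ht', FunSpace.next_apply]
  -- The Picard fixed points are Lipschitz in the initial point for the sup distance, hence at each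
  -- time t.
  · obtain ⟨L', h⟩ := FunSpace.exists_forall_closedBall_funSpace_dist_le_mul hf
    refine fun t ht ↦ (LipschitzOnWith.of_dist_le_mul (K := L') fun x hx y hy ↦ ?_).continuousOn
    simp_rw [hφ']
    rw [dif_pos hx, dif_pos hy, FunSpace.compProj_apply, FunSpace.compProj_apply,
      ← FunSpace.toContinuousMap_apply_eq_apply, ← FunSpace.toContinuousMap_apply_eq_apply]
    have : Nonempty (Icc tmin tmax) := ⟨t₀⟩
    apply ContinuousMap.dist_le_iff_of_nonempty.mp
    exact h x y hx hy (φ x hx) (φ y hy) (hφ x hx) (hφ y hy)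

/-! ### Planar loops and the height gained by lifting them -/

section PlanarControl

/-- The first coordinate of a planar curve from `0` to `(w.1, w.2.1)` carrying a loop of signed area
proportional to `w.2.2.1 * w.2.2.2`. -/
def ctrlU (w : ℝ × ℝ × ℝ × ℝ) (t : ℝ) : ℝ := w.1 * t + w.2.2.1 * (t - t ^ 2)

/-- The second coordinate of the planar curve. -/
def ctrlV (w : ℝ × ℝ × ℝ × ℝ) (t : ℝ) : ℝ :=
  w.2.1 * t + w.2.2.2 * (t - 3 * t ^ 2 + 2 * t ^ 3)

/-- The derivative of `ctrlU w`. -/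
def ctrlU' (w : ℝ × ℝ × ℝ × ℝ) (t : ℝ) : ℝ := w.1 + w.2.2.1 * (1 - 2 * t)

/-- The derivative of `ctrlV w`. -/
def ctrlV' (w : ℝ × ℝ × ℝ × ℝ) (t : ℝ) : ℝ := w.2.1 + w.2.2.2 * (1 - 6 * t + 6 * t ^ 2)

theorem hasDerivAt_ctrlU (w : ℝ × ℝ × ℝ × ℝ) (t : ℝ) : HasDerivAt (ctrlU w) (ctrlU' w t) t := by
  have h := ((hasDerivAt_id t).const_mul w.1).add
    (((hasDerivAt_id t).sub ((hasDerivAt_id t).pow 2)).const_mul w.2.2.1)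
  refine h.congr_deriv ?_
  simp [ctrlU']

theorem hasDerivAt_ctrlV (w : ℝ × ℝ × ℝ × ℝ) (t : ℝ) : HasDerivAt (ctrlV w) (ctrlV' w t) t := by
  have h := ((hasDerivAt_id t).const_mul w.2.1).add
    ((((hasDerivAt_id t).sub (((hasDerivAt_id t).pow 2).const_mul 3)).add
      (((hasDerivAt_id t).pow 3).const_mul 2)).const_mul w.2.2.2)
  refine h.congr_deriv ?_
  simp only [ctrlV', id]
  ring

theorem abs_add_mul_le {x y c d m : ℝ} (hx : |x| ≤ m) (hy : |y| ≤ m) (hc : |c| ≤ 1)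
    (hd : |d| ≤ 1) : |x * c + y * d| ≤ 2 * m := by
  have h1 : |x * c| ≤ m * 1 := by
    rw [abs_mul]; exact mul_le_mul hx hc (abs_nonneg _) ((abs_nonneg _).trans hx)
  have h2 : |y * d| ≤ m * 1 := by
    rw [abs_mul]; exact mul_le_mul hy hd (abs_nonneg _) ((abs_nonneg _).trans hy)
  calc |x * c + y * d| ≤ |x * c| + |y * d| := abs_add_le _ _
    _ ≤ 2 * m := by linarith

/-- Each function is a combination of two entries of w with coefficients of absolute value at most 1
on the unit interval. -/
theorem ctrl_bounds (w : ℝ × ℝ × ℝ × ℝ) {t : ℝ} (ht : t ∈ Set.Icc (0 : ℝ) 1) :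
    |ctrlU w t| ≤ 2 * ‖w‖ ∧ |ctrlV w t| ≤ 2 * ‖w‖ ∧ |ctrlU' w t| ≤ 2 * ‖w‖ ∧
      |ctrlV' w t| ≤ 2 * ‖w‖ := by
  obtain ⟨h0, h1⟩ := ht
  have n1 : |w.1| ≤ ‖w‖ := norm_fst_le w
  have n2 : |w.2.1| ≤ ‖w‖ := (norm_fst_le w.2).trans (norm_snd_le w)
  have n3 : |w.2.2.1| ≤ ‖w‖ := (norm_fst_le w.2.2).trans ((norm_snd_le w.2).trans (norm_snd_le w))
  have n4 : |w.2.2.2| ≤ ‖w‖ := (norm_snd_le w.2.2).trans ((norm_snd_le w.2).trans (norm_snd_le w))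
  have b0 : |t| ≤ 1 := abs_le.2 ⟨by linarith, h1⟩
  have b : |(1 : ℝ)| ≤ 1 := by simp
  have hp : 0 ≤ t * (1 - t) := mul_nonneg h0 (by linarith)
  have hq : t * (1 - t) ≤ 1 / 4 := by nlinarith [sq_nonneg (t - 1 / 2)]
  have b1 : |t - t ^ 2| ≤ 1 := abs_le.2 ⟨by nlinarith, by nlinarith⟩
  have b2 : |t - 3 * t ^ 2 + 2 * t ^ 3| ≤ 1 := by
    have e : t - 3 * t ^ 2 + 2 * t ^ 3 = t * (1 - t) * (1 - 2 * t) := by ring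
    rw [e]
    exact abs_le.2 ⟨by nlinarith, by nlinarith⟩
  have b3 : |1 - 2 * t| ≤ 1 := abs_le.2 ⟨by linarith, by linarith⟩
  have b4 : |1 - 6 * t + 6 * t ^ 2| ≤ 1 := abs_le.2 ⟨by nlinarith, by nlinarith⟩
  refine ⟨abs_add_mul_le n1 n3 b0 b1, abs_add_mul_le n2 n4 b0 b2, ?_, ?_⟩
  · simpa [ctrlU'] using abs_add_mul_le n1 n3 b b3
  · simpa [ctrlV'] using abs_add_mul_le n2 n4 b b4

theorem ctrl_sub (w w' : ℝ × ℝ × ℝ × ℝ) (t : ℝ) :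
    ctrlU (w - w') t = ctrlU w t - ctrlU w' t ∧ ctrlV (w - w') t = ctrlV w t - ctrlV w' t ∧
    ctrlU' (w - w') t = ctrlU' w t - ctrlU' w' t ∧
    ctrlV' (w - w') t = ctrlV' w t - ctrlV' w' t := by
  simp only [ctrlU, ctrlV, ctrlU', ctrlV', Prod.fst_sub, Prod.snd_sub]
  refine ⟨?_, ?_, ?_, ?_⟩ <;> ring

/-- The point of the lifted curve. -/
def ctrlPt (y : (ℝ × ℝ × ℝ × ℝ) × ℝ) (t : ℝ) : ℝ × ℝ × ℝ := (ctrlU y.1 t, ctrlV y.1 t, y.2)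

theorem ctrlPt_sub (y y' : (ℝ × ℝ × ℝ × ℝ) × ℝ) (t : ℝ) :
    ctrlPt y t - ctrlPt y' t = ctrlPt (y - y') t := by
  obtain ⟨h1, h2, -, -⟩ := ctrl_sub y.1 y'.1 t
  simp [ctrlPt, h1, h2]

theorem norm_ctrlPt_le (y : (ℝ × ℝ × ℝ × ℝ) × ℝ) {t : ℝ} (ht : t ∈ Set.Icc (0 : ℝ) 1) :
    ‖ctrlPt y t‖ ≤ 2 * ‖y‖ := by
  obtain ⟨h1, h2, -, -⟩ := ctrl_bounds y.1 ht
  have n1 : ‖y.1‖ ≤ ‖y‖ := norm_fst_le y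
  have n2 : |y.2| ≤ ‖y‖ := norm_snd_le y
  have n3 := norm_nonneg y
  simp only [ctrlPt, Prod.norm_def, Real.norm_eq_abs] at *
  refine max_le (by linarith) (max_le (by linarith) (by linarith))

/-- The control system `z' = A u' + B v'` along the planar curves, the parameters of the curve
being part of the state. -/
def ctrlField (A B : ℝ × ℝ × ℝ → ℝ) (t : ℝ) (y : (ℝ × ℝ × ℝ × ℝ) × ℝ) :
    (ℝ × ℝ × ℝ × ℝ) × ℝ :=
  (0, A (ctrlPt y t) * ctrlU' y.1 t + B (ctrlPt y t) * ctrlV' y.1 t)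

theorem contDiff_ctrl :
    ContDiff ℝ ∞ (fun p : ℝ × ((ℝ × ℝ × ℝ × ℝ) × ℝ) => ctrlPt p.2 p.1) ∧
    ContDiff ℝ ∞ (fun p : ℝ × ((ℝ × ℝ × ℝ × ℝ) × ℝ) => ctrlU' p.2.1 p.1) ∧
    ContDiff ℝ ∞ (fun p : ℝ × ((ℝ × ℝ × ℝ × ℝ) × ℝ) => ctrlV' p.2.1 p.1) := by
  simp only [ctrlPt, ctrlU, ctrlV, ctrlU', ctrlV']
  refine ⟨?_, ?_, ?_⟩ <;> fun_prop

theorem norm_zero_mk (x : ℝ) : ‖((0 : ℝ × ℝ × ℝ × ℝ), x)‖ = |x| := by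
  simp [Prod.norm_def]

theorem abs_mul_sub_mul_le {x x' y y' p q m n : ℝ} (hx : |x - x'| ≤ p) (hy : |y| ≤ m)
    (hx' : |x'| ≤ n) (hyy : |y - y'| ≤ q) : |x * y - x' * y'| ≤ p * m + n * q := by
  have e : x * y - x' * y' = (x - x') * y + x' * (y - y') := by ring
  rw [e]
  refine (abs_add_le _ _).trans (add_le_add ?_ ?_)
  · rw [abs_mul]; exact mul_le_mul hx hy (abs_nonneg _) ((abs_nonneg _).trans hx)
  · rw [abs_mul]; exact mul_le_mul hx' hyy (abs_nonneg _) ((abs_nonneg _).trans hx')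

-- Since A and B vanish at 0, they are at most 2Ka along the curves, and u', v' are at most 2a. The
-- speed is thus quadratic in a, and 16Ka ≤ 1 keeps a solution started in the ball of radius a/2
-- inside the ball of radius a for unit time. The quadratic bound is also what later makes the
-- effect of z on A and B negligible against the area term.
open Set Metric in
theorem isPicardLindelof_ctrlField {A B : ℝ × ℝ × ℝ → ℝ} {K a ρ : NNReal}
    (hA : LipschitzOnWith K A (closedBall 0 ρ)) (hB : LipschitzOnWith K B (closedBall 0 ρ))
    (hA0 : A 0 = 0) (hB0 : B 0 = 0) (haρ : 2 * a ≤ ρ) (haK : 16 * K * a ≤ 1) :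
    IsPicardLindelof (tmin := 0) (tmax := 1) (ctrlField A B) ⟨0, by simp⟩ 0 a (a / 2)
      (8 * K * a ^ 2) (16 * K * a) := by
  have haρ' : 2 * (a : ℝ) ≤ ρ := by exact_mod_cast haρ
  have haK' : 16 * (K : ℝ) * a ≤ 1 := by exact_mod_cast haK
  have mem : ∀ t ∈ Icc (0 : ℝ) 1, ∀ y ∈ closedBall (0 : (ℝ × ℝ × ℝ × ℝ) × ℝ) a,
      ctrlPt y t ∈ closedBall (0 : ℝ × ℝ × ℝ) ρ := by
    intro t ht y hy
    rw [mem_closedBall_zero_iff] at *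
    exact (norm_ctrlPt_le y ht).trans (by linarith)
  have small : ∀ C : ℝ × ℝ × ℝ → ℝ, LipschitzOnWith K C (closedBall 0 ρ) → C 0 = 0 →
      ∀ t ∈ Icc (0 : ℝ) 1, ∀ y ∈ closedBall (0 : (ℝ × ℝ × ℝ × ℝ) × ℝ) a,
        |C (ctrlPt y t)| ≤ K * (2 * a) := by
    intro C hC hC0 t ht y hy
    have h := hC.dist_le_mul _ (mem t ht y hy) 0 (by simp)
    rw [hC0, dist_zero_right, dist_zero_right, Real.norm_eq_abs] at h
    refine h.trans (mul_le_mul_of_nonneg_left ((norm_ctrlPt_le y ht).trans ?_) K.2)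
    rw [mem_closedBall_zero_iff] at hy
    linarith
  have cont : ∀ C : ℝ × ℝ × ℝ → ℝ, LipschitzOnWith K C (closedBall 0 ρ) →
      ∀ y ∈ closedBall (0 : (ℝ × ℝ × ℝ × ℝ) × ℝ) a,
        ContinuousOn (fun t => C (ctrlPt y t)) (Icc 0 1) := by
    intro C hC y hy
    refine hC.continuousOn.comp ?_ fun t ht => mem t ht y hy
    exact (contDiff_ctrl.1.continuous.comp (by fun_prop : Continuous fun t : ℝ => (t, y))).continuousOn
  have lip : ∀ C : ℝ × ℝ × ℝ → ℝ, LipschitzOnWith K C (closedBall 0 ρ) →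
      ∀ t ∈ Icc (0 : ℝ) 1, ∀ y ∈ closedBall (0 : (ℝ × ℝ × ℝ × ℝ) × ℝ) a,
        ∀ y' ∈ closedBall (0 : (ℝ × ℝ × ℝ × ℝ) × ℝ) a,
        |C (ctrlPt y t) - C (ctrlPt y' t)| ≤ K * (2 * ‖y - y'‖) := by
    intro C hC t ht y hy y' hy'
    have h := hC.dist_le_mul _ (mem t ht y hy) _ (mem t ht y' hy')
    rw [Real.dist_eq, dist_eq_norm, ctrlPt_sub] at h
    exact h.trans (mul_le_mul_of_nonneg_left (norm_ctrlPt_le _ ht) K.2)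
  refine ⟨fun t ht => LipschitzOnWith.of_dist_le_mul fun y hy y' hy' => ?_, fun y hy => ?_,
    fun t ht y hy => ?_, ?_⟩
  · obtain ⟨-, -, u1, v1⟩ := ctrl_bounds y.1 ht
    obtain ⟨-, -, u2, v2⟩ := ctrl_bounds (y.1 - y'.1) ht
    obtain ⟨-, -, u3, v3⟩ := ctrl_sub y.1 y'.1 t
    rw [u3] at u2
    rw [v3] at v2
    have ny : ‖y.1‖ ≤ a := (norm_fst_le y).trans (by simpa using hy)
    have nd : ‖y.1 - y'.1‖ ≤ ‖y - y'‖ := norm_fst_le (y - y')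
    have h1 := abs_mul_sub_mul_le (lip A hA t ht y hy y' hy') (u1.trans (by linarith))
      (small A hA hA0 t ht y' hy') (u2.trans (mul_le_mul_of_nonneg_left nd zero_le_two))
      (m := 2 * a)
    have h2 := abs_mul_sub_mul_le (lip B hB t ht y hy y' hy') (v1.trans (by linarith))
      (small B hB hB0 t ht y' hy') (v2.trans (mul_le_mul_of_nonneg_left nd zero_le_two))
      (m := 2 * a)
    have h3 := (abs_add_le _ _).trans (add_le_add h1 h2)
    rw [dist_eq_norm, dist_eq_norm]
    simp only [ctrlField, Prod.mk_sub_mk, sub_zero, norm_zero_mk]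
    rw [add_sub_add_comm]
    refine h3.trans (le_of_eq ?_)
    push_cast
    ring
  · refine continuousOn_const.prodMk (((cont A hA y hy).mul ?_).add ((cont B hB y hy).mul ?_))
    · exact (contDiff_ctrl.2.1.continuous.comp
        (by fun_prop : Continuous fun t : ℝ => (t, y))).continuousOn
    · exact (contDiff_ctrl.2.2.continuous.comp
        (by fun_prop : Continuous fun t : ℝ => (t, y))).continuousOn
  · obtain ⟨-, -, u1, v1⟩ := ctrl_bounds y.1 ht
    have ny : ‖y.1‖ ≤ a := (norm_fst_le y).trans (by simpa using hy)
    have h1 := abs_mul_sub_mul_le (x' := 0) (q := 0) (n := 0) (m := 2 * a)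
      (y' := ctrlU' y.1 t) (by simpa using small A hA hA0 t ht y hy)
      (u1.trans (by linarith)) (by simp) (by simp)
    have h2 := abs_mul_sub_mul_le (x' := 0) (q := 0) (n := 0) (m := 2 * a)
      (y' := ctrlV' y.1 t) (by simpa using small B hB hB0 t ht y hy)
      (v1.trans (by linarith)) (by simp) (by simp)
    simp only [zero_mul, sub_zero, add_zero] at h1 h2
    simp only [ctrlField, norm_zero_mk]
    refine ((abs_add_le _ _).trans (add_le_add h1 h2)).trans (le_of_eq ?_)
    push_cast
    ring
  · simp only [sub_zero, sub_self]
    rw [max_eq_left zero_le_one]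
    push_cast
    nlinarith [a.2, mul_le_mul_of_nonneg_right haK' a.2]

open Set Metric in
/-- The gain in `z` along the loop with parameters `s₁, s₂` is, to second order, a non-zero multiple
of `s₁ s₂` times `∂B/∂u - ∂A/∂v`. -/
theorem abs_ctrl_gain_le {A B : ℝ × ℝ × ℝ → ℝ} {l m : ℝ × ℝ × ℝ →L[ℝ] ℝ} {K a ε δ s₁ s₂ : ℝ}
    (hε : 0 ≤ ε)
    (hl : ‖l‖ ≤ K) (hm : ‖m‖ ≤ K)
    (hA : ∀ q, ‖q‖ ≤ 2 * a → |A q - l q| ≤ ε * ‖q‖)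
    (hB : ∀ q, ‖q‖ ≤ 2 * a → |B q - m q| ≤ ε * ‖q‖)
    {z : ℝ → ℝ} (hz0 : z 0 = 0)
    (hz : ∀ t ∈ Icc (0 : ℝ) 1, HasDerivWithinAt z
      (ctrlField A B t ((0, 0, s₁, s₂), z t)).2 (Icc 0 1) t)
    (hza : ∀ t ∈ Icc (0 : ℝ) 1, ‖(((0 : ℝ), (0 : ℝ), s₁, s₂), z t)‖ ≤ a)
    (hzδ : ∀ t ∈ Icc (0 : ℝ) 1, |z t| ≤ δ) :
    |z 1 + (m (1, 0, 0) - l (0, 1, 0)) * (s₁ * s₂) / 30| ≤ 8 * ε * a ^ 2 + 4 * K * δ * a := by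
  set w : ℝ × ℝ × ℝ × ℝ := (0, 0, s₁, s₂) with hw
  have lin : ∀ (k : ℝ × ℝ × ℝ →L[ℝ] ℝ) (x y c : ℝ),
      k (x, y, c) = x * k (1, 0, 0) + y * k (0, 1, 0) + c * k (0, 0, 1) := by
    intro k x y c
    have : ((x, y, c) : ℝ × ℝ × ℝ) = x • (1, 0, 0) + y • (0, 1, 0) + c • (0, 0, 1) := by simp
    rw [this]
    simp only [map_add, map_smul, smul_eq_mul]
  have last : ∀ k : ℝ × ℝ × ℝ →L[ℝ] ℝ, ‖k‖ ≤ K → |k (0, 0, 1)| ≤ K := fun k hk => by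
    have h := k.le_opNorm (0, 0, 1)
    have : ‖((0 : ℝ), (0 : ℝ), (1 : ℝ))‖ = 1 := by simp [Prod.norm_def]
    rw [this, mul_one] at h
    exact h.trans hk
  -- Primitive of the right-hand side with A, B replaced by their linear parts and z by 0. All terms
  -- but the last are exact and vanish on the closed loop. The last is (∂B/∂u - ∂A/∂v) ∫ u dv, and ∫
  -- (t - t²)(1 - 6t + 6t²) dt over the unit interval is -1/30.
  let Q : ℝ → ℝ := fun t => l (1, 0, 0) * (ctrlU w t * ctrlU w t) / 2
    + m (0, 1, 0) * (ctrlV w t * ctrlV w t) / 2 + l (0, 1, 0) * (ctrlU w t * ctrlV w t)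
    + (m (1, 0, 0) - l (0, 1, 0)) *
      ((s₁ * s₂) * (t ^ 2 / 2 - 7 * t ^ 3 / 3 + 3 * t ^ 4 - 6 * t ^ 5 / 5))
  have hQ : ∀ t, HasDerivAt Q
      ((ctrlU w t * l (1, 0, 0) + ctrlV w t * l (0, 1, 0)) * ctrlU' w t
        + (ctrlU w t * m (1, 0, 0) + ctrlV w t * m (0, 1, 0)) * ctrlV' w t) t := by
    intro t
    have hu := hasDerivAt_ctrlU w t
    have hv := hasDerivAt_ctrlV w t
    have hp : ∀ n : ℕ, HasDerivAt (fun t : ℝ => t ^ n) (n * t ^ (n - 1)) t := fun n =>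
      hasDerivAt_pow n t
    have h := (((((hu.mul hu).const_mul (l (1, 0, 0))).div_const 2).add
      (((hv.mul hv).const_mul (m (0, 1, 0))).div_const 2)).add
      ((hu.mul hv).const_mul (l (0, 1, 0)))).add
      ((((((hp 2).div_const 2).sub (((hp 3).const_mul 7).div_const 3)).add
        ((hp 4).const_mul 3)).sub (((hp 5).const_mul 6).div_const 5)).const_mul (s₁ * s₂)
        |>.const_mul (m (1, 0, 0) - l (0, 1, 0)))
    refine h.congr_deriv ?_
    simp only [hw, ctrlU, ctrlV, ctrlU', ctrlV']
    push_cast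
    ring
  -- Two errors: ε · 2a from linearizing the coefficient, and δK from dropping z; both are
  -- multiplied by the speed bound 2a.
  have est : ∀ t ∈ Icc (0 : ℝ) 1, ∀ (C : ℝ × ℝ × ℝ → ℝ) (k : ℝ × ℝ × ℝ →L[ℝ] ℝ), ‖k‖ ≤ K →
      (∀ q, ‖q‖ ≤ 2 * a → |C q - k q| ≤ ε * ‖q‖) → ∀ d, |d| ≤ 2 * a →
      |C (ctrlPt (w, z t) t) * d - (ctrlU w t * k (1, 0, 0) + ctrlV w t * k (0, 1, 0)) * d|
        ≤ (ε * (2 * a) + δ * K) * (2 * a) := by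
    intro t ht C k hk hC d hd
    have hq : ‖ctrlPt (w, z t) t‖ ≤ 2 * a := (norm_ctrlPt_le _ ht).trans (by linarith [hza t ht])
    have h1 := (hC _ hq).trans (mul_le_mul_of_nonneg_left hq hε)
    have h2 : |z t * k (0, 0, 1)| ≤ δ * K := by
      rw [abs_mul]
      exact mul_le_mul (hzδ t ht) (last k hk) (abs_nonneg _) ((abs_nonneg _).trans (hzδ t ht))
    have h3 := (abs_add_le _ _).trans (add_le_add h1 h2)
    rw [← sub_mul, abs_mul]
    refine mul_le_mul (le_trans (le_of_eq ?_) h3) hd (abs_nonneg _) ((abs_nonneg _).trans h3)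
    congr 1
    rw [show k (ctrlPt (w, z t) t) = _ from lin k _ _ _]
    ring
  have key := Convex.norm_image_sub_le_of_norm_hasDerivWithin_le (s := Icc (0 : ℝ) 1)
    (f := fun t => z t - Q t) (C := 8 * ε * a ^ 2 + 4 * K * δ * a) (x := 0) (y := 1)
    (fun t ht => (hz t ht).sub (hQ t).hasDerivWithinAt) ?_ (convex_Icc 0 1) (by simp) (by simp)
  · have hQ0 : Q 0 = 0 := by simp [Q, hw, ctrlU, ctrlV]
    have hQ1 : Q 1 = - ((m (1, 0, 0) - l (0, 1, 0)) * (s₁ * s₂) / 30) := by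
      simp only [Q, hw, ctrlU, ctrlV]
      ring
    simp only [hz0, hQ0, hQ1, sub_zero, norm_one, mul_one, Real.norm_eq_abs, sub_neg_eq_add] at key
    exact key
  · intro t ht
    obtain ⟨-, -, u1, v1⟩ := ctrl_bounds w ht
    have nw : ‖w‖ ≤ a := (norm_fst_le (w, z t)).trans (hza t ht)
    have h1 := est t ht A l hl hA (ctrlU' w t) (by linarith)
    have h2 := est t ht B m hm hB (ctrlV' w t) (by linarith)
    rw [Real.norm_eq_abs]
    simp only [ctrlField]
    rw [add_sub_add_comm]
    refine ((abs_add_le _ _).trans (add_le_add h1 h2)).trans (le_of_eq ?_)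
    ring

end PlanarControl

/-! ### Local reachability in the model system -/

open Set Metric in
/-- If `∂B/∂u ≠ ∂A/∂v` at `0`, where `A = B = 0`, then every point near `0` is the endpoint of a
smooth curve starting at `0` and satisfying `z' = A u' + B v'`. -/
theorem eventually_exists_lift {A B : ℝ × ℝ × ℝ → ℝ} {O : Set (ℝ × ℝ × ℝ)} (hO : O ∈ 𝓝 0)
    (hA : ContDiffOn ℝ ∞ A O) (hB : ContDiffOn ℝ ∞ B O) (hA0 : A 0 = 0) (hB0 : B 0 = 0)
    (hκ : fderiv ℝ B 0 (1, 0, 0) - fderiv ℝ A 0 (0, 1, 0) ≠ 0) :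
    ∀ᶠ q in 𝓝 (0 : ℝ × ℝ × ℝ), ∃ c : ℝ → ℝ × ℝ × ℝ, ContDiffOn ℝ ∞ c (Icc 0 1) ∧
      MapsTo c (Icc 0 1) O ∧ c 0 = 0 ∧ c 1 = q ∧ ∀ t ∈ Icc (0 : ℝ) 1, ∃ u' v' : ℝ,
        HasDerivWithinAt c (u', v', A (c t) * u' + B (c t) * v') (Icc 0 1) t := by
  set κ := fderiv ℝ B 0 (1, 0, 0) - fderiv ℝ A 0 (0, 1, 0) with hκdef
  have hκpos : 0 < |κ| := abs_pos.2 hκ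
  have hA1 : ContDiffAt ℝ 1 A 0 := (hA.contDiffAt hO).of_le (by simp)
  have hB1 : ContDiffAt ℝ 1 B 0 := (hB.contDiffAt hO).of_le (by simp)
  obtain ⟨KA, TA, hTA, hLA⟩ := hA1.exists_lipschitzOnWith
  obtain ⟨KB, TB, hTB, hLB⟩ := hB1.exists_lipschitzOnWith
  obtain ⟨K, hK1, hKA, hKB, hKl, hKm⟩ : ∃ K : NNReal, 1 ≤ K ∧ KA ≤ K ∧ KB ≤ K ∧
      ‖fderiv ℝ A 0‖ ≤ K ∧ ‖fderiv ℝ B 0‖ ≤ K := by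
    refine ⟨1 + KA + KB + ‖fderiv ℝ A 0‖₊ + ‖fderiv ℝ B 0‖₊, ?_, ?_, ?_, ?_, ?_⟩
    · rw [add_assoc, add_assoc, add_assoc]; exact le_self_add
    · rw [← NNReal.coe_le_coe]; push_cast
      linarith [KB.2, norm_nonneg (fderiv ℝ A 0), norm_nonneg (fderiv ℝ B 0)]
    · rw [← NNReal.coe_le_coe]; push_cast
      linarith [KA.2, norm_nonneg (fderiv ℝ A 0), norm_nonneg (fderiv ℝ B 0)]
    · push_cast
      linarith [KA.2, KB.2, norm_nonneg (fderiv ℝ A 0), norm_nonneg (fderiv ℝ B 0)]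
    · push_cast
      linarith [KA.2, KB.2, norm_nonneg (fderiv ℝ A 0), norm_nonneg (fderiv ℝ B 0)]
  have hK1' : (1 : ℝ) ≤ K := by exact_mod_cast hK1
  have approx : ∀ C : ℝ × ℝ × ℝ → ℝ, ContDiffAt ℝ 1 C 0 → C 0 = 0 →
      ∀ᶠ q in 𝓝 (0 : ℝ × ℝ × ℝ), |C q - fderiv ℝ C 0 q| ≤ |κ| / 2000 * ‖q‖ := by
    intro C hC hC0
    have h := (hC.differentiableAt one_ne_zero).hasFDerivAt.isLittleO.def
      (c := |κ| / 2000) (by positivity)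
    filter_upwards [h] with q hq
    simpa [hC0] using hq
  obtain ⟨ρ₀, hρ₀, hball⟩ := nhds_basis_closedBall.mem_iff.1 (Filter.inter_mem
    (Filter.inter_mem hO (Filter.inter_mem hTA hTB))
    (Filter.inter_mem (approx A hA1 hA0) (approx B hB1 hB0)))
  lift ρ₀ to NNReal using hρ₀.le with ρ
  have hLA' : LipschitzOnWith K A (closedBall 0 ρ) :=
    (hLA.mono fun q hq => (hball hq).1.2.1).weaken hKA
  have hLB' : LipschitzOnWith K B (closedBall 0 ρ) :=
    (hLB.mono fun q hq => (hball hq).1.2.2).weaken hKB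
  -- The first two bounds serve Picard–Lindelöf; the last makes the cubic error 32K²a³ smaller than
  -- what the area term, of order |κ|a², leaves over.
  obtain ⟨a, ha, haρ, haK, haκ⟩ : ∃ a : NNReal, 0 < a ∧ 2 * a ≤ ρ ∧ 16 * K * a ≤ 1 ∧
      8000 * (K : ℝ) ^ 2 * a ≤ |κ| := by
    have hK0 : (0 : ℝ) < K := by linarith
    have hK2 : (0 : ℝ) < K ^ 2 := by positivity
    have hpos : 0 < min (min ((ρ : ℝ) / 2) (1 / (16 * K))) (|κ| / (8000 * K ^ 2)) := by
      refine lt_min (lt_min (by linarith) (by positivity)) (by positivity)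
    obtain ⟨b, hb, hb1, hb2, hb3⟩ : ∃ b : ℝ, 0 < b ∧ b ≤ ρ / 2 ∧ b ≤ 1 / (16 * K) ∧
        b ≤ |κ| / (8000 * K ^ 2) :=
      ⟨_, hpos, (min_le_left _ _).trans (min_le_left _ _),
        (min_le_left _ _).trans (min_le_right _ _), min_le_right _ _⟩
    lift b to NNReal using hb.le
    rw [le_div_iff₀ (by positivity)] at hb2 hb3
    refine ⟨b, hb, ?_, ?_, by linarith⟩
    · rw [← NNReal.coe_le_coe]; push_cast; linarith
    · rw [← NNReal.coe_le_coe]; push_cast; linarith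
  have ha' : (0 : ℝ) < a := ha
  have haρ' : 2 * (a : ℝ) ≤ ρ := by exact_mod_cast haρ
  have hPL := isPicardLindelof_ctrlField hLA' hLB' hA0 hB0 haρ haK
  obtain ⟨φ, hφ, hφc⟩ := hPL.exists_continuousOn_flow_mem_closedBall
  set r : ℝ := a / 2 with hr
  have hr0 : 0 < r := by positivity
  have hra : ((a / 2 : NNReal) : ℝ) = r := by simp [hr]
  rw [hra] at hφ hφc
  -- the parameters are constant along the flow
  have hconst : ∀ w : ℝ × ℝ × ℝ × ℝ, ‖w‖ ≤ r → ((w, 0) : (ℝ × ℝ × ℝ × ℝ) × ℝ) ∈ closedBall 0 r ∧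
      ∀ t ∈ Icc (0 : ℝ) 1, (φ (w, 0) t).1 = w := by
    intro w hw
    have hmem : ((w, 0) : (ℝ × ℝ × ℝ × ℝ) × ℝ) ∈ closedBall 0 r := by
      rw [mem_closedBall_zero_iff]
      exact max_le hw (by simpa using hr0.le)
    refine ⟨hmem, fun t ht => ?_⟩
    have hd : ∀ t ∈ Icc (0 : ℝ) 1, HasDerivWithinAt (fun t => (φ (w, 0) t).1) 0 (Icc 0 1) t :=
      fun t ht => ((hφ _ hmem).2 t ht).2.fst
    have := Convex.norm_image_sub_le_of_norm_hasDerivWithin_le (C := 0) hd (by simp)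
      (convex_Icc 0 1) (show (0 : ℝ) ∈ Icc 0 1 by simp) ht
    have h0 : φ (w, 0) 0 = (w, 0) := (hφ _ hmem).1
    rw [zero_mul, norm_le_zero_iff, sub_eq_zero, h0] at this
    exact this
  have hz : ∀ w : ℝ × ℝ × ℝ × ℝ, ‖w‖ ≤ r → ∀ t ∈ Icc (0 : ℝ) 1, φ (w, 0) t = (w, (φ (w, 0) t).2) :=
    fun w hw t ht => Prod.ext ((hconst w hw).2 t ht) rfl
  -- every point reached with small parameters is an endpoint
  have hend : ∀ w : ℝ × ℝ × ℝ × ℝ, ‖w‖ ≤ r → ∃ c : ℝ → ℝ × ℝ × ℝ, ContDiffOn ℝ ∞ c (Icc 0 1) ∧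
      MapsTo c (Icc 0 1) O ∧ c 0 = 0 ∧ c 1 = (w.1, w.2.1, (φ (w, 0) 1).2) ∧
      ∀ t ∈ Icc (0 : ℝ) 1, ∃ u' v' : ℝ,
        HasDerivWithinAt c (u', v', A (c t) * u' + B (c t) * v') (Icc 0 1) t := by
    intro w hw
    obtain ⟨hmem, -⟩ := hconst w hw
    have hmaps : ∀ t ∈ Icc (0 : ℝ) 1, ∀ y ∈ closedBall (0 : (ℝ × ℝ × ℝ × ℝ) × ℝ) a,
        ctrlPt y t ∈ O := by
      intro t ht y hy
      refine (hball ?_).1.1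
      rw [mem_closedBall_zero_iff] at *
      exact (norm_ctrlPt_le y ht).trans (by linarith)
    have hsm : ContDiffOn ℝ ∞ (φ (w, 0)) (Icc 0 1) := by
      refine ODE.contDiffOn_enat_Icc_of_hasDerivWithinAt (n := ⊤) (f := ctrlField A B)
        (u := closedBall 0 a) ?_ (fun t ht => ((hφ _ hmem).2 t ht).2)
        (fun t ht => ((hφ _ hmem).2 t ht).1)
      obtain ⟨h1, h2, h3⟩ := contDiff_ctrl
      have h4 : ∀ C : ℝ × ℝ × ℝ → ℝ, ContDiffOn ℝ ∞ C O → ContDiffOn ℝ ∞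
          (fun p : ℝ × ((ℝ × ℝ × ℝ × ℝ) × ℝ) => C (ctrlPt p.2 p.1))
          (Icc (0 : ℝ) 1 ×ˢ closedBall (0 : (ℝ × ℝ × ℝ × ℝ) × ℝ) a) := fun C hC =>
        hC.comp h1.contDiffOn fun p hp => hmaps p.1 hp.1 p.2 hp.2
      exact contDiffOn_const.prodMk
        (((h4 A hA).mul h2.contDiffOn).add ((h4 B hB).mul h3.contDiffOn))
    refine ⟨fun t => ctrlPt (φ (w, 0) t) t, ?_, fun t ht => hmaps t ht _ ((hφ _ hmem).2 t ht).1,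
      ?_, ?_, fun t ht => ⟨ctrlU' w t, ctrlV' w t, ?_⟩⟩
    · exact contDiff_ctrl.1.comp_contDiffOn (contDiffOn_id.prodMk hsm)
    · have h0 : φ (w, 0) 0 = (w, 0) := (hφ _ hmem).1
      simp [h0, ctrlPt, ctrlU, ctrlV]
    · simp only
      rw [hz w hw 1 (by simp)]
      simp [ctrlPt, ctrlU, ctrlV]
      norm_num
    · have hd := ((hφ _ hmem).2 t ht).2.snd
      have hd' := (hasDerivAt_ctrlU w t).hasDerivWithinAt.prodMk
        ((hasDerivAt_ctrlV w t).hasDerivWithinAt.prodMk hd)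
      have hd'' := hd'.congr_of_mem (f₁ := fun t => ctrlPt (φ (w, 0) t) t) (fun s hs => by
        simp only [ctrlPt]; rw [(hconst w hw).2 s hs]) ht
      refine hd''.congr_deriv ?_
      simp only [ctrlField]
      rw [(hconst w hw).2 t ht]
  -- the gain along the two loops
  have hgain : ∀ s : ℝ, |s| = r → |(φ ((0, 0, r, s), 0) 1).2 + κ * (r * s) / 30| < |κ| * r ^ 2 / 30 := by
    intro s hs
    have hw : ‖((0 : ℝ), (0 : ℝ), r, s)‖ ≤ r := by
      simp only [Prod.norm_def, norm_zero, Real.norm_eq_abs, hs, abs_of_pos hr0]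
      simp [hr0.le]
    obtain ⟨hmem, -⟩ := hconst _ hw
    have h0 : φ ((0, 0, r, s), 0) 0 = ((0, 0, r, s), 0) := (hφ _ hmem).1
    have hin : ∀ q : ℝ × ℝ × ℝ, ‖q‖ ≤ 2 * a → q ∈ closedBall (0 : ℝ × ℝ × ℝ) ρ := fun q hq => by
      rw [mem_closedBall_zero_iff]; linarith
    have hder : ∀ t ∈ Icc (0 : ℝ) 1, HasDerivWithinAt (fun t => (φ ((0, 0, r, s), 0) t).2)
        (ctrlField A B t ((0, 0, r, s), (φ ((0, 0, r, s), 0) t).2)).2 (Icc 0 1) t := by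
      intro t ht
      rw [← hz _ hw t ht]
      exact ((hφ _ hmem).2 t ht).2.snd
    have hin' : ∀ t ∈ Icc (0 : ℝ) 1,
        ‖(((0 : ℝ), (0 : ℝ), r, s), (φ ((0, 0, r, s), 0) t).2)‖ ≤ a := by
      intro t ht
      rw [← hz _ hw t ht]
      simpa using ((hφ _ hmem).2 t ht).1
    have hδ : ∀ t ∈ Icc (0 : ℝ) 1, |(φ ((0, 0, r, s), 0) t).2| ≤ 8 * K * a ^ 2 := by
      intro t ht
      have h := Convex.norm_image_sub_le_of_norm_hasDerivWithin_le (C := 8 * K * a ^ 2) hder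
        (fun t ht => (norm_snd_le _).trans
          (hPL.norm_le t ht _ (by rw [mem_closedBall_zero_iff]; exact hin' t ht)))
        (convex_Icc 0 1) (show (0 : ℝ) ∈ Icc 0 1 by simp) ht
      simp only [h0, sub_zero, Real.norm_eq_abs] at h
      refine h.trans (mul_le_of_le_one_right (by positivity) ?_)
      exact abs_le.2 ⟨by linarith [ht.1], ht.2⟩
    have h := abs_ctrl_gain_le (ε := |κ| / 2000) (by positivity) hKl hKm
      (fun q hq => (hball (hin q hq)).2.1) (fun q hq => (hball (hin q hq)).2.2)
      (by simp [h0]) hder hin' hδ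
    refine h.trans_lt ?_
    -- With r = a/2 the area term is |κ|a²/120. The linearization error is |κ|a²/250 and the cubic
    -- one at most |κ|a²/250, so their sum is smaller.
    have e : |κ| * r ^ 2 / 30 - (8 * (|κ| / 2000) * a ^ 2 + 4 * K * (8 * K * a ^ 2) * a)
      = a ^ 2 * (|κ| * (1 / 120 - 8 / 2000) - 32 * K ^ 2 * a) := by rw [hr]; ring
    have : 0 < |κ| * (1 / 120 - 8 / 2000) - 32 * (K : ℝ) ^ 2 * a := by linarith
    have := mul_pos (pow_pos ha' 2) this
    linarith
  -- Reversing the sign of s reverses the signed area, so the two loops end on opposite sides of z =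
  -- 0. A negative product records this without fixing the sign of κ.
  have hsign : ((φ ((0, 0, r, -r), 0) 1).2 - 0) * ((φ ((0, 0, r, r), 0) 1).2 - 0) < 0 := by
    have h1 := abs_lt.1 (hgain r (abs_of_pos hr0))
    have h2 := abs_lt.1 (hgain (-r) (by rw [abs_neg, abs_of_pos hr0]))
    have e1 : κ * (r * r) / 30 = κ * r ^ 2 / 30 := by ring
    have e2 : κ * (r * -r) / 30 = -(κ * r ^ 2 / 30) := by ring
    rw [e1] at h1
    rw [e2] at h2
    rw [sub_zero, sub_zero]
    rcases lt_or_gt_of_ne hκ with h | h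
    · rw [abs_of_neg h] at h1 h2
      exact mul_neg_of_neg_of_pos (by linarith) (by linarith)
    · rw [abs_of_pos h] at h1 h2
      exact mul_neg_of_pos_of_neg (by linarith) (by linarith)
  have hball_w : ∀ p : ℝ × ℝ, ‖p‖ ≤ r → ∀ s, |s| ≤ r → ‖(p.1, p.2, r, s)‖ ≤ r := by
    intro p hp s hs
    have h1 : |p.1| ≤ r := (norm_fst_le p).trans hp
    have h2 : |p.2| ≤ r := (norm_snd_le p).trans hp
    simp only [Prod.norm_def, Real.norm_eq_abs, abs_of_pos hr0]
    exact max_le h1 (max_le h2 (max_le le_rfl hs))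
  have hφ1 : ContinuousOn (fun y => (φ y 1).2) (closedBall 0 r) :=
    continuous_snd.comp_continuousOn (hφc 1 (by simp))
  have hcont : ∀ s, |s| ≤ r → ContinuousAt (fun q : ℝ × ℝ × ℝ =>
      (φ ((q.1, q.2.1, r, s), 0) 1).2 - q.2.2) 0 := by
    intro s hs
    refine ContinuousAt.sub (ContinuousOn.continuousAt (s := closedBall 0 r)
      (hφ1.comp (by fun_prop) fun q hq => ?_) (closedBall_mem_nhds _ hr0)) (by fun_prop)
    refine (hconst _ (hball_w (q.1, q.2.1) ?_ s hs)).1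
    rw [mem_closedBall_zero_iff] at hq
    exact max_le ((norm_fst_le q).trans hq) ((norm_fst_le q.2).trans ((norm_snd_le q).trans hq))
  have hev := ((hcont (-r) (by rw [abs_neg, abs_of_pos hr0])).mul
    (hcont r (abs_of_pos hr0).le)).eventually_lt continuousAt_const hsign
  filter_upwards [hev, closedBall_mem_nhds (0 : ℝ × ℝ × ℝ) hr0] with q hq hqr
  rw [mem_closedBall_zero_iff] at hqr
  have hp : ‖(q.1, q.2.1)‖ ≤ r :=
    max_le ((norm_fst_le q).trans hqr) ((norm_fst_le q.2).trans ((norm_snd_le q).trans hqr))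
  -- The target (u, v) and the first loop parameter r stay fixed; only the second loop parameter
  -- moves.
  have hIVT := intermediate_value_uIcc (a := -r) (b := r)
    (f := fun s => (φ ((q.1, q.2.1, r, s), 0) 1).2)
    (hφ1.comp (by fun_prop) fun s hs => (hconst _ (hball_w (q.1, q.2.1) hp s (by
      rw [uIcc_of_le (by linarith)] at hs; exact abs_le.2 hs))).1)
  obtain ⟨s, hs, hsq⟩ := hIVT (show q.2.2 ∈ _ by
    rw [mem_uIcc]
    rcases mul_neg_iff.1 hq with h | h
    · exact Or.inr ⟨by linarith [h.2], by linarith [h.1]⟩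
    · exact Or.inl ⟨by linarith [h.1], by linarith [h.2]⟩)
  rw [uIcc_of_le (by linarith)] at hs
  obtain ⟨c, h1, h2, h3, h4, h5⟩ := hend _ (hball_w (q.1, q.2.1) hp s (abs_le.2 hs))
  refine ⟨c, h1, h2, h3, ?_, h5⟩
  rw [h4]
  simp only at hsq
  rw [hsq]

/-! ### Concatenation of horizontal paths -/

/-- `γ` is a smooth path in `B` from `x` to `y`, tangent to `ker α`, which rests at its endpoints
outside of the unit interval. -/
structure IsHorizontalPath {E : Type*} [NormedAddCommGroup E] [NormedSpace ℝ E]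
    (α : E → E →L[ℝ] ℝ) (B : Set E) (x y : E) (γ : ℝ → E) : Prop where
  smooth : ContDiff ℝ ∞ γ
  mem : ∀ t, γ t ∈ B
  tangent : ∀ t, α (γ t) (deriv γ t) = 0
  left : ∀ t ≤ 0, γ t = x
  right : ∀ t ≥ 1, γ t = y

namespace IsHorizontalPath

variable {E : Type*} [NormedAddCommGroup E] [NormedSpace ℝ E]
  {α : E → E →L[ℝ] ℝ} {B : Set E} {x y z : E} {γ γ' : ℝ → E}

theorem symm (h : IsHorizontalPath α B x y γ) :
    IsHorizontalPath α B y x (fun t => γ (1 - t)) where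
  smooth := h.smooth.comp (contDiff_const.sub contDiff_id)
  mem t := h.mem _
  tangent t := by rw [deriv_comp_const_sub, map_neg, h.tangent, neg_zero]
  left t ht := h.right _ (by linarith)
  right t ht := h.left _ (by linarith)

/-- The first piece has arrived at y by time 1/3 and the second leaves only at 2/3. Both are
constant in between, so switching at 1/2 does not affect smoothness. -/
theorem trans (h : IsHorizontalPath α B x y γ) (h' : IsHorizontalPath α B y z γ') :
    IsHorizontalPath α B x z (fun t => if t < 1 / 2 then γ (3 * t) else γ' (3 * t - 2)) := by
  set δ : ℝ → E := fun t => if t < 1 / 2 then γ (3 * t) else γ' (3 * t - 2) with hδ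
  have germ : ∀ t, δ =ᶠ[𝓝 t] (fun t => γ (3 * t)) ∨ δ =ᶠ[𝓝 t] fun t => γ' (3 * t - 2) := by
    intro t
    rcases lt_or_ge t (1 / 2) with ht | ht
    · left
      filter_upwards [Iio_mem_nhds ht] with s hs
      exact if_pos hs
    · right
      filter_upwards [Ioi_mem_nhds (show 1 / 3 < t by linarith)] with s hs
      rw [Set.mem_Ioi] at hs
      by_cases h2 : s < 1 / 2
      · simp only [hδ, if_pos h2]
        rw [h.right _ (by linarith), h'.left _ (by linarith)]
      · exact if_neg h2
  have s1 : ContDiff ℝ ∞ (fun t => γ (3 * t)) := h.smooth.comp (contDiff_const.mul contDiff_id)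
  have s2 : ContDiff ℝ ∞ (fun t => γ' (3 * t - 2)) :=
    h'.smooth.comp ((contDiff_const.mul contDiff_id).sub contDiff_const)
  have d1 : ∀ t, HasDerivAt (fun t => γ (3 * t)) ((3 : ℝ) • deriv γ (3 * t)) t := fun t => by
    have := ((h.smooth.differentiable (by simp)) (3 * t)).hasDerivAt.scomp t
      ((hasDerivAt_id t).const_mul 3)
    simpa [Function.comp_def] using this
  have d2 : ∀ t, HasDerivAt (fun t => γ' (3 * t - 2)) ((3 : ℝ) • deriv γ' (3 * t - 2)) t :=
    fun t => by
      have := ((h'.smooth.differentiable (by simp)) (3 * t - 2)).hasDerivAt.scomp t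
        (((hasDerivAt_id t).const_mul 3).sub_const 2)
      simpa [Function.comp_def] using this
  refine ⟨contDiff_iff_contDiffAt.2 fun t => ?_, fun t => ?_, fun t => ?_, fun t ht => ?_,
    fun t ht => ?_⟩
  · rcases germ t with g | g
    · exact s1.contDiffAt.congr_of_eventuallyEq g
    · exact s2.contDiffAt.congr_of_eventuallyEq g
  · simp only [hδ]
    split_ifs
    exacts [h.mem _, h'.mem _]
  · rcases germ t with g | g
    · rw [g.deriv_eq, g.eq_of_nhds, (d1 t).deriv, map_smul, h.tangent, smul_zero]
    · rw [g.deriv_eq, g.eq_of_nhds, (d2 t).deriv, map_smul, h'.tangent, smul_zero]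
  · simp only [hδ]
    rw [if_pos (by linarith)]
    exact h.left _ (by linarith)
  · simp only [hδ]
    rw [if_neg (by linarith)]
    exact h'.right _ (by linarith)

/-- Tangency survives reparametrization, and a smooth step function makes the path rest at both
ends. It takes values in the unit interval, so one-sided regularity of c at 0 and 1 is enough for
the chain rule. -/
theorem of_contDiffOn {c : ℝ → E} (hc : ContDiffOn ℝ ∞ c (Set.Icc 0 1))
    (hB : Set.MapsTo c (Set.Icc 0 1) B)
    (hα : ∀ t ∈ Set.Icc (0 : ℝ) 1, ∃ v, HasDerivWithinAt c v (Set.Icc 0 1) t ∧ α (c t) v = 0) :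
    IsHorizontalPath α B (c 0) (c 1) (fun t => c (Real.smoothTransition t)) := by
  have hm : ∀ t, Real.smoothTransition t ∈ Set.Icc (0 : ℝ) 1 := fun t =>
    ⟨Real.smoothTransition.nonneg t, Real.smoothTransition.le_one t⟩
  have hs : ContDiff ℝ ∞ Real.smoothTransition := Real.smoothTransition.contDiff
  refine ⟨?_, fun t => hB (hm t), fun t => ?_, fun t ht => ?_, fun t ht => ?_⟩
  · rw [← contDiffOn_univ]
    exact hc.comp hs.contDiffOn fun t _ => hm t
  · obtain ⟨v, hv, hv0⟩ := hα _ (hm t)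
    have h2 := hs.differentiable (by simp) t |>.hasDerivAt
    have h := hv.scomp_hasDerivAt t h2 hm
    have h' : deriv (fun t => c (Real.smoothTransition t)) t = _ := h.deriv
    rw [h', map_smul, hv0, smul_zero]
  · rw [Real.smoothTransition.zero_of_nonpos ht]
  · rw [Real.smoothTransition.one_of_one_le ht]

end IsHorizontalPath

/-! ### From the contact condition to reachability -/

/-- At a point where `α ∧ dα ≠ 0` there is a basis of `ℝ³` adapted to `ker α`. -/
theorem exists_adapted_frame {α : E3 → E3 →L[ℝ] ℝ} {x : E3} (hα : DifferentiableAt ℝ α x)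
    (h : ∃ u v w : E3, wedgeD α x u v w ≠ 0) :
    ∃ e₁ e₂ e₃ : E3, α x e₁ = 0 ∧ α x e₂ = 0 ∧ α x e₃ = 1 ∧
      fderiv ℝ α x e₁ e₂ - fderiv ℝ α x e₂ e₁ ≠ 0 := by
  obtain ⟨u, v, w, h⟩ := h
  have hne : ∃ e, α x e ≠ 0 := by
    by_contra! h0
    exact h (by simp [wedgeD, h0])
  obtain ⟨e, he⟩ := hne
  set f : E3 := (α x e)⁻¹ • e with hf
  have hf1 : α x f = 1 := by simp [hf, he]
  have hk : ∀ u, α x (u - α x u • f) = 0 := fun u => by simp [hf1]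
  -- If dα vanished on ker α, projecting u, v, w to ker α along f would give α ∧ dα = 0: in the
  -- alternating sum the terms dα(f, ·) cancel.
  by_contra! H
  refine h ?_
  have h1 := H _ _ f (hk v) (hk w) hf1
  have h2 := H _ _ f (hk u) (hk w) hf1
  have h3 := H _ _ f (hk u) (hk v) hf1
  simp only [wedgeD, dOneForm_apply _ _ _ _ hα]
  simp only [map_sub, map_smul, sub_apply, smul_apply,
    smul_eq_mul] at h1 h2 h3
  linear_combination α x u * h1 - α x v * h2 + α x w * h3

/-- Linear coordinates given by an adapted frame. -/
theorem exists_frame_equiv {l : E3 →L[ℝ] ℝ} {Ω : E3 →L[ℝ] E3 →L[ℝ] ℝ} {e₁ e₂ e₃ : E3}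
    (h1 : l e₁ = 0) (h2 : l e₂ = 0) (h3 : l e₃ = 1) (hΩ : Ω e₁ e₂ - Ω e₂ e₁ ≠ 0) :
    ∃ G : (ℝ × ℝ × ℝ) ≃L[ℝ] E3, ∀ q, G q = q.1 • e₁ + q.2.1 • e₂ + q.2.2 • e₃ := by
  let g : ℝ × ℝ × ℝ →ₗ[ℝ] E3 :=
    { toFun := fun q => q.1 • e₁ + q.2.1 • e₂ + q.2.2 • e₃
      map_add' := fun p q => by simp only [Prod.fst_add, Prod.snd_add]; module
      map_smul' := fun c q => by
        simp only [Prod.smul_fst, Prod.smul_snd, smul_eq_mul, RingHom.id_apply]; module }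
  have hg : ∀ q, g q = q.1 • e₁ + q.2.1 • e₂ + q.2.2 • e₃ := fun q => rfl
  have hinj : Function.Injective g := by
    rw [← LinearMap.ker_eq_bot, LinearMap.ker_eq_bot']
    rintro ⟨a, b, c⟩ hq
    rw [hg] at hq
    have hc : c = 0 := by simpa [h1, h2, h3] using congrArg l hq
    subst hc
    simp only [zero_smul, add_zero] at hq
    -- Pairing with e₁ and e₂ under the antisymmetrization of Ω isolates b and a.
    have r1 : Ω e₁ (a • e₁ + b • e₂) - Ω (a • e₁ + b • e₂) e₁ = 0 := by rw [hq]; simp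
    have r2 : Ω e₂ (a • e₁ + b • e₂) - Ω (a • e₁ + b • e₂) e₂ = 0 := by rw [hq]; simp
    simp only [map_add, map_smul, add_apply, smul_apply,
      smul_eq_mul] at r1 r2
    have hb : b * (Ω e₁ e₂ - Ω e₂ e₁) = 0 := by linear_combination r1
    have ha : a * (Ω e₁ e₂ - Ω e₂ e₁) = 0 := by linear_combination -r2
    simp [(mul_eq_zero.1 hb).resolve_right hΩ, (mul_eq_zero.1 ha).resolve_right hΩ]
  refine ⟨(LinearEquiv.ofInjectiveOfFinrankEq g hinj (by simp)).toContinuousLinearEquiv,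
    fun q => ?_⟩
  rfl

/-- The points that can be reached from `x` by horizontal paths in `B` form a neighbourhood
of `x`. -/
theorem eventually_exists_isHorizontalPath {α : E3 → E3 →L[ℝ] ℝ} {B : Set E3} (hB : IsOpen B)
    (hα : ContDiffOn ℝ ∞ α B) (hw : ∀ x ∈ B, ∃ u v w : E3, wedgeD α x u v w ≠ 0)
    {x : E3} (hx : x ∈ B) : ∀ᶠ y in 𝓝 x, ∃ γ, IsHorizontalPath α B x y γ := by
  have hαx : DifferentiableAt ℝ α x :=
    (hα.contDiffAt (hB.mem_nhds hx)).differentiableAt (by simp)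
  obtain ⟨e₁, e₂, e₃, h1, h2, h3, hω⟩ := exists_adapted_frame hαx (hw x hx)
  obtain ⟨G, hG⟩ := exists_frame_equiv h1 h2 h3 hω
  set T : ℝ × ℝ × ℝ → E3 := fun q => x + G q with hT
  have hTs : ContDiff ℝ ∞ T := contDiff_const.add G.contDiff
  have hT0 : T 0 = x := by simp [hT]
  have hTd : ∀ q, HasFDerivAt T (G : ℝ × ℝ × ℝ →L[ℝ] E3) q := fun q =>
    G.hasFDerivAt.const_add x
  set O : Set (ℝ × ℝ × ℝ) := T ⁻¹' (B ∩ {y | y ∈ B → α y e₃ ≠ 0}) with hO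
  have hOB : ∀ q ∈ O, T q ∈ B ∧ α (T q) e₃ ≠ 0 := fun q hq => ⟨hq.1, hq.2 hq.1⟩
  have hOn : O ∈ 𝓝 0 := by
    refine hTs.continuous.continuousAt.preimage_mem_nhds ?_
    rw [hT0]
    refine Filter.inter_mem (hB.mem_nhds hx) ?_
    have hc : ContinuousAt (fun y => α y e₃) x := hαx.continuousAt.clm_apply continuousAt_const
    filter_upwards [hc.eventually_ne (show α x e₃ ≠ 0 by simp [h3])] with y hy _ using hy
  have hcoef : ∀ e, ContDiffOn ℝ ∞ (fun q => -(α (T q) e / α (T q) e₃)) O := by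
    intro e
    have hαT : ContDiffOn ℝ ∞ (fun q => α (T q)) O :=
      hα.comp hTs.contDiffOn fun q hq => hq.1
    exact ((hαT.clm_apply contDiffOn_const).div (hαT.clm_apply contDiffOn_const)
      fun q hq => (hOB q hq).2).neg
  -- The numerator vanishes at 0 and the denominator is 1 there, so the denominator's derivative
  -- drops out. Consequently κ = -dα(e₁, e₂).
  have hfd : ∀ e, α x e = 0 → ∀ q, fderiv ℝ (fun q => -(α (T q) e / α (T q) e₃)) 0 q
      = -(fderiv ℝ α x (G q) e) := by
    intro e he q
    have hαT : HasFDerivAt (fun q => α (T q)) ((fderiv ℝ α x).comp (G : ℝ × ℝ × ℝ →L[ℝ] E3)) 0 :=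
      HasFDerivAt.comp (g := α) 0 (by rw [hT0]; exact hαx.hasFDerivAt) (hTd 0)
    have n := hαT.clm_apply (hasFDerivAt_const e (0 : ℝ × ℝ × ℝ))
    have d := hαT.clm_apply (hasFDerivAt_const e₃ (0 : ℝ × ℝ × ℝ))
    have h := (n.mul ((hasDerivAt_inv (show α (T 0) e₃ ≠ 0 by rw [hT0, h3]; exact one_ne_zero)).comp_hasFDerivAt
      0 d)).neg
    have h' : fderiv ℝ (fun q => -(α (T q) e * (α (T q) e₃)⁻¹)) 0 = _ := h.fderiv
    simp only [div_eq_mul_inv]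
    rw [h']
    simp [hT0, he, h3]
  have hG1 : G (1, 0, 0) = e₁ := by simp [hG]
  have hG2 : G (0, 1, 0) = e₂ := by simp [hG]
  have key := eventually_exists_lift hOn (hcoef e₁) (hcoef e₂) (by simp [hT0, h1])
    (by simp [hT0, h2]) (by
      rw [hfd e₂ h2, hfd e₁ h1, hG1, hG2]
      intro h0
      exact hω (by linarith))
  have hpull : Filter.Tendsto (fun y => G.symm (y - x)) (𝓝 x) (𝓝 0) := by
    have : Continuous fun y => G.symm (y - x) := by fun_prop
    simpa using this.tendsto x
  filter_upwards [hpull.eventually key] with y hy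
  obtain ⟨c, hc, hcO, hc0, hc1, hcd⟩ := hy
  have hp := IsHorizontalPath.of_contDiffOn (α := α) (B := B) (hTs.comp_contDiffOn hc)
    (fun t ht => (hOB _ (hcO ht)).1) ?_
  · have e0 : (T ∘ c) 0 = x := by simp [hc0, hT0]
    have e1 : (T ∘ c) 1 = y := by simp [hc1, hT]
    rw [e0, e1] at hp
    exact ⟨_, hp⟩
  · intro t ht
    obtain ⟨u', v', hd⟩ := hcd t ht
    refine ⟨_, (hTd (c t)).comp_hasDerivWithinAt t hd, ?_⟩
    have hne := (hOB _ (hcO ht)).2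
    simp only [ContinuousLinearEquiv.coe_coe, hG, map_add, map_smul, smul_eq_mul,
      Function.comp_apply]
    field_simp
    ring

/-- Any two points of a connected open set with a contact form are joined by a horizontal path. -/
theorem exists_isHorizontalPath {α : E3 → E3 →L[ℝ] ℝ} {B : Set E3} (hB : IsOpen B)
    (hBc : IsPreconnected B) (hα : ContDiffOn ℝ ∞ α B)
    (hw : ∀ x ∈ B, ∃ u v w : E3, wedgeD α x u v w ≠ 0) {x y : E3} (hx : x ∈ B) (hy : y ∈ B) :
    ∃ γ, IsHorizontalPath α B x y γ :=
  hBc.induction₂ (fun x y => ∃ γ, IsHorizontalPath α B x y γ)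
    (fun _ hx => nhdsWithin_le_nhds (eventually_exists_isHorizontalPath hB hα hw hx))
    (fun _ _ _ _ _ _ ⟨_, h⟩ ⟨_, h'⟩ => ⟨_, h.trans h'⟩) (fun _ _ _ _ ⟨_, h⟩ => ⟨_, h.symm⟩) hx hy

/-! ### Legendrian paths in M and the global approximation -/

section Legendrian

variable {M : Type*} [TopologicalSpace M] [ChartedSpace E3 M]

/-- A smooth Legendrian path in `O` from `x` to `y`, which rests at its endpoints outside of the
unit interval. -/
structure ContactStructure.IsLegendrianPath (ξ : ContactStructure M) (O : Set M) (x y : M)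
    (γ : ℝ → M) : Prop where
  isLegendrian : ξ.IsLegendrian 𝓘(ℝ, ℝ) γ
  mem : ∀ t, γ t ∈ O
  left : ∀ t ≤ 0, γ t = x
  right : ∀ t ≥ 1, γ t = y

/-- A map that is locally a smooth function followed by a Legendrian curve is Legendrian. -/
theorem ContactStructure.isLegendrian_of_eventuallyEq_comp (ξ : ContactStructure M)
    {E H N : Type*} [NormedAddCommGroup E] [NormedSpace ℝ E] [TopologicalSpace H]
    {J : ModelWithCorners ℝ E H} [TopologicalSpace N] [ChartedSpace H N] {η : N → M}
    (h : ∀ t, ∃ (γ : ℝ → M) (f : N → ℝ), ξ.IsLegendrian 𝓘(ℝ, ℝ) γ ∧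
      ContMDiffAt J 𝓘(ℝ, ℝ) ∞ f t ∧ η =ᶠ[𝓝 t] γ ∘ f) :
    ξ.IsLegendrian J η where
  smooth t := by
    obtain ⟨γ, f, hγ, hf, e⟩ := h t
    exact ((hγ.smooth _).comp t hf).congr_of_eventuallyEq e
  tangent t v := by
    obtain ⟨γ, f, hγ, hf, e⟩ := h t
    -- All tangent spaces unfold to `E3`; this untyped form lets the base point be rewritten
    -- separately from the vector.
    let P : M → E3 → Prop := fun m w => (show TangentSpace (𝓡 3) m from w) ∈ ξ.plane m
    change P (η t) (mfderiv J (𝓡 3) η t v)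
    have hd : mfderiv J (𝓡 3) η t = mfderiv J (𝓡 3) (γ ∘ f) t := e.mfderiv_eq
    have hc : mfderiv J (𝓡 3) (γ ∘ f) t = _ :=
      mfderiv_comp t ((hγ.smooth _).mdifferentiableAt (by simp)) (hf.mdifferentiableAt (by simp))
    rw [e.eq_of_nhds, hd, hc]
    exact hγ.tangent (f t) (mfderiv J 𝓘(ℝ, ℝ) f t v)

variable [IsManifold (𝓡 3) ∞ M]

/-- The image in `M` of a horizontal path in a chart is Legendrian. -/
theorem IsLocalContactForm.isLegendrian_symm_comp {ξ : ContactStructure M} {p : M} {V : Set E3}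
    {α : E3 → E3 →L[ℝ] ℝ} (h : IsLocalContactForm ξ.plane p V α) {B : Set E3} (hB : B ⊆ V)
    {x y : E3} {γ : ℝ → E3} (hγ : IsHorizontalPath α B x y γ) :
    ξ.IsLegendrian 𝓘(ℝ, ℝ) ((extChartAt (𝓡 3) p).symm ∘ γ) := by
  set φ := extChartAt (𝓡 3) p with hφ
  have ht : ∀ t, γ t ∈ φ.target := fun t => h.subset_target (hB (hγ.mem t))
  have hs : ContMDiff 𝓘(ℝ, ℝ) (𝓡 3) ∞ (φ.symm ∘ γ) := by
    rw [← contMDiffOn_univ]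
    exact (contMDiffOn_extChartAt_symm p).comp hγ.smooth.contMDiff.contMDiffOn fun t _ => ht t
  refine ⟨hs, fun t v => ?_⟩
  have hsrc : φ.symm (γ t) ∈ φ.source := φ.map_target (ht t)
  have hright : φ (φ.symm (γ t)) = γ t := φ.right_inv (ht t)
  have hker := h.ker_eq (φ.symm (γ t)) hsrc (by rw [← hφ, hright]; exact hB (hγ.mem t))
  rw [show (φ.symm ∘ γ) t = φ.symm (γ t) from rfl, hker]
  have hφd : MDifferentiableAt (𝓡 3) 𝓘(ℝ, E3) φ ((φ.symm ∘ γ) t) :=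
    (contMDiffAt_extChartAt' (n := ∞) (by
      rwa [hφ, extChartAt_source] at hsrc)).mdifferentiableAt (by simp)
  have hcomp : mfderiv 𝓘(ℝ, ℝ) 𝓘(ℝ, E3) (φ ∘ (φ.symm ∘ γ)) t = _ :=
    mfderiv_comp t hφd ((hs t).mdifferentiableAt (by simp))
  have heq : φ ∘ (φ.symm ∘ γ) = γ := funext fun t => φ.right_inv (ht t)
  rw [heq, mfderiv_eq_fderiv] at hcomp
  have hv : mfderiv (𝓡 3) 𝓘(ℝ, E3) φ (φ.symm (γ t))
      (mfderiv 𝓘(ℝ, ℝ) (𝓡 3) (φ.symm ∘ γ) t v) = fderiv ℝ γ t v := by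
    rw [hcomp]; rfl
  change α (φ (φ.symm (γ t))) (mfderiv (𝓡 3) 𝓘(ℝ, E3) φ (φ.symm (γ t))
      (mfderiv 𝓘(ℝ, ℝ) (𝓡 3) (φ.symm ∘ γ) t v)) = 0
  rw [hv, hright]
  have e : fderiv ℝ γ t v = (show ℝ from v) • deriv γ t := by
    rw [← fderiv_apply_one_eq_deriv, ← map_smul, smul_eq_mul, mul_one]
  rw [e, map_smul, hγ.tangent, smul_zero]

/-- Every point has arbitrarily small open neighbourhoods, any two points of which are joined by
a Legendrian path inside the neighbourhood. -/
theorem ContactStructure.exists_isOpen_joined (ξ : ContactStructure M) {p : M} {S : Set M}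
    (hS : S ∈ 𝓝 p) : ∃ O ⊆ S, IsOpen O ∧ p ∈ O ∧
      ∀ x ∈ O, ∀ y ∈ O, ∃ γ, ξ.IsLegendrianPath O x y γ := by
  obtain ⟨V, α, h⟩ := ξ.exists_form p
  have hcont : ContinuousAt (extChartAt (𝓡 3) p).symm (extChartAt (𝓡 3) p p) :=
    continuousAt_extChartAt_symm p
  have hpre := hcont.preimage_mem_nhds (t := S) (by
    rwa [extChartAt_to_inv])
  obtain ⟨r, hr, hball⟩ := Metric.mem_nhds_iff.1
    (Filter.inter_mem (h.isOpen.mem_nhds h.mem) hpre)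
  set B := Metric.ball (extChartAt (𝓡 3) p p) r with hBdef
  have hBV : B ⊆ V := fun y hy => (hball hy).1
  refine ⟨(extChartAt (𝓡 3) p).source ∩ extChartAt (𝓡 3) p ⁻¹' B, ?_,
    isOpen_extChartAt_preimage' p Metric.isOpen_ball,
    ⟨mem_extChartAt_source p, Metric.mem_ball_self hr⟩, ?_⟩
  · rintro q ⟨hq, hqB⟩
    have := (hball hqB).2
    rwa [Set.mem_preimage, (extChartAt (𝓡 3) p).left_inv hq] at this
  · rintro x ⟨hx, hxB⟩ y ⟨hy, hyB⟩
    obtain ⟨γ, hγ⟩ := exists_isHorizontalPath Metric.isOpen_ball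
      (convex_ball _ _).isPreconnected (h.smooth.mono hBV)
      (fun z hz => h.wedge_ne_zero z (hBV hz)) hxB hyB
    refine ⟨_, h.isLegendrian_symm_comp hBV hγ, fun t => ?_, fun t ht => ?_, fun t ht => ?_⟩
    · have ht := h.subset_target (hBV (hγ.mem t))
      refine ⟨(extChartAt (𝓡 3) p).map_target ht, ?_⟩
      rw [Set.mem_preimage, Function.comp_apply, (extChartAt (𝓡 3) p).right_inv ht]
      exact hγ.mem t
    · rw [Function.comp_apply, hγ.left t ht, (extChartAt (𝓡 3) p).left_inv hx]
    · rw [Function.comp_apply, hγ.right t ht, (extChartAt (𝓡 3) p).left_inv hy]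

/-- Legendrian approximation along a uniformly continuous parametrization `p` of a compact space,
with a Legendrian curve that inherits a prescribed period of `p`. -/
theorem ContactStructure.exists_legendrian_approx (ξ : ContactStructure M)
    {N : Type*} [PseudoMetricSpace N] [CompactSpace N] {p : ℝ → N} (hp : UniformContinuous p)
    (υ : C(N, M)) {W : Set (N × M)} (hW : IsOpen W) (hυ : ∀ t, (t, υ t) ∈ W) {L : ℝ} (hL : 0 < L) :
    ∃ Γ : ℝ → M, ξ.IsLegendrian 𝓘(ℝ, ℝ) Γ ∧ (∀ t, (p t, Γ t) ∈ W) ∧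
      (Function.Periodic p L → Function.Periodic Γ L) := by
  have hloc : ∀ t : N, ∃ (A : Set N) (O : Set M), IsOpen A ∧ t ∈ A ∧ (∀ s ∈ A, υ s ∈ O) ∧
      (∀ s ∈ A, ∀ m ∈ O, (s, m) ∈ W) ∧ ∀ x ∈ O, ∀ y ∈ O, ∃ γ, ξ.IsLegendrianPath O x y γ := by
    intro t
    obtain ⟨A, S, hA, hS, htA, htS, hAS⟩ := isOpen_prod_iff.1 hW t (υ t) (hυ t)
    obtain ⟨O, hOS, hO, htO, hOj⟩ := ξ.exists_isOpen_joined (hS.mem_nhds htS)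
    exact ⟨A ∩ υ ⁻¹' O, O, hA.inter (hO.preimage υ.continuous), ⟨htA, htO⟩, fun s hs => hs.2,
      fun s hs m hm => hAS ⟨hs.1, hOS hm⟩, hOj⟩
  choose A O hA htA hυO hAO hOj using hloc
  obtain ⟨δ, hδ, hleb⟩ := lebesgue_number_lemma_of_metric (s := Set.univ) isCompact_univ hA
    (fun t _ => Set.mem_iUnion.2 ⟨t, htA t⟩)
  -- Each path is compatible with W over the whole δ-ball, so its timing is free. It is chosen from
  -- the pair of points of N, not from an index, so that a period of p passes to the final curve.
  have hpaths : ∀ q q' : N, ∃ γ, dist q' q < δ →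
      ξ.IsLegendrianPath {m | ∀ s ∈ Metric.ball q δ, (s, m) ∈ W} (υ q) (υ q') γ := by
    intro q q'
    by_cases hd : dist q' q < δ
    · obtain ⟨i, hi⟩ := hleb q trivial
      obtain ⟨γ, hγ⟩ := hOj i _ (hυO i q (hi (Metric.mem_ball_self hδ))) _ (hυO i q' (hi hd))
      exact ⟨γ, fun _ => ⟨hγ.isLegendrian, fun t s hs => hAO i s (hi hs) _ (hγ.mem t),
        hγ.left, hγ.right⟩⟩
    · exact ⟨fun _ => υ q, fun h => absurd h hd⟩
  choose G hG using hpaths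
  obtain ⟨δ', hδ', huc⟩ := Metric.uniformContinuous_iff.1 hp δ hδ
  obtain ⟨n, hn⟩ := exists_nat_gt (L / δ')
  have hn0 : (0 : ℝ) < n := (div_pos hL hδ').trans hn
  set h : ℝ := L / n with hh
  have hh0 : 0 < h := div_pos hL hn0
  have hhδ : h < δ' := by
    rw [div_lt_iff₀ hδ'] at hn
    rw [hh, div_lt_iff₀ hn0]
    linarith
  have hGi : ∀ i : ℤ, ξ.IsLegendrianPath {m | ∀ s ∈ Metric.ball (p (i * h)) δ, (s, m) ∈ W}
      (υ (p (i * h))) (υ (p ((i + 1) * h))) (G (p (i * h)) (p ((i + 1) * h))) := by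
    intro i
    refine hG _ _ (huc ?_)
    rw [Real.dist_eq, show ((i : ℝ) + 1) * h - i * h = h by ring, abs_of_pos hh0]
    exact hhδ
  -- The path moves only in the middle third of its step, so consecutive pieces agree near the
  -- common node. As h = L / n, a shift by L shifts the index by n.
  let F : ℤ → ℝ → M := fun i t => G (p (i * h)) (p ((i + 1) * h)) (3 * (t / h - i) - 1)
  have hfloor : ∀ t : ℝ, ∃ i : ℤ, (fun s => F ⌊s / h⌋ s) =ᶠ[𝓝 t] F i := by
    intro t
    refine ⟨⌊t / h⌋, ?_⟩
    have hc : ContinuousAt (fun s : ℝ => s / h) t := by fun_prop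
    rcases (Int.floor_le (t / h)).lt_or_eq with hlt | heq
    · filter_upwards [hc.eventually_lt continuousAt_const (Int.lt_floor_add_one (t / h)),
        continuousAt_const.eventually_lt hc hlt] with s h1 h2
      rw [Int.floor_eq_iff.2 ⟨h2.le, h1⟩]
    · set m := ⌊t / h⌋ with hm
      filter_upwards [hc.eventually_lt continuousAt_const (show t / h < (m : ℝ) + 1 / 3 by linarith),
        continuousAt_const.eventually_lt hc (show (m : ℝ) - 1 / 3 < t / h by linarith)] with s h1 h2
      rcases le_or_gt (m : ℝ) (s / h) with h3 | h3
      · rw [Int.floor_eq_iff.2 ⟨h3, by linarith⟩]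
      · have hf : ⌊s / h⌋ = m - 1 := by
          rw [Int.floor_eq_iff]; push_cast; exact ⟨by linarith, by linarith⟩
        rw [hf]
        simp only [F]
        rw [(hGi (m - 1)).right _ (by push_cast; linarith), (hGi m).left _ (by linarith)]
        push_cast
        rw [sub_add_cancel]
  refine ⟨fun t => F ⌊t / h⌋ t, ?_, fun t => ?_, fun hper t => ?_⟩
  · refine ξ.isLegendrian_of_eventuallyEq_comp fun t => ?_
    obtain ⟨i, hi⟩ := hfloor t
    refine ⟨_, fun s => 3 * (s / h - i) - 1, (hGi i).isLegendrian, ?_, hi⟩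
    exact ContDiff.contMDiff (by fun_prop) _
  · refine (hGi ⌊t / h⌋).mem _ (p t) (huc ?_)
    have h1 := Int.floor_le (t / h)
    have h2 := Int.lt_floor_add_one (t / h)
    rw [le_div_iff₀ hh0] at h1
    rw [div_lt_iff₀ hh0] at h2
    rw [Real.dist_eq, abs_lt]
    constructor <;> linarith
  · have e : (t + L) / h = t / h + n := by rw [add_div, hh]; field_simp
    have e1 : ∀ x : ℝ, (x + n) * h = x * h + L := fun x => by rw [hh]; field_simp
    simp only [F]
    rw [e, Int.floor_add_natCast]
    push_cast
    rw [show (⌊t / h⌋ : ℝ) + n + 1 = (⌊t / h⌋ + 1) + n by ring, e1, e1, hper, hper,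
      add_sub_add_right_eq_sub]

end Legendrian

/-! ### Whitney neighbourhoods, the circle, and the conclusion -/

/-- The sets of maps with graph in a given open set form a basis of the Whitney topology. -/
theorem exists_graph_subset_of_isOpen_whitneyC0 {N M : Type*} [TopologicalSpace N]
    [TopologicalSpace M] {𝒰 : Set C(N, M)} (h : IsOpen[whitneyC0 N M] 𝒰) {υ : C(N, M)}
    (hυ : υ ∈ 𝒰) : ∃ W : Set (N × M), IsOpen W ∧ (∀ t, (t, υ t) ∈ W) ∧
      ∀ f : C(N, M), (∀ t, (t, f t) ∈ W) → f ∈ 𝒰 := by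
  change TopologicalSpace.GenerateOpen _ 𝒰 at h
  induction h with
  | basic s hs =>
    obtain ⟨W, hW, rfl⟩ := hs
    exact ⟨W, hW, hυ, fun f hf => hf⟩
  | univ => exact ⟨Set.univ, isOpen_univ, fun _ => trivial, fun _ _ => trivial⟩
  | inter s t _ _ ihs iht =>
    obtain ⟨W₁, h₁, h₁', h₁''⟩ := ihs hυ.1
    obtain ⟨W₂, h₂, h₂', h₂''⟩ := iht hυ.2
    exact ⟨W₁ ∩ W₂, h₁.inter h₂, fun t => ⟨h₁' t, h₂' t⟩,
      fun f hf => ⟨h₁'' f fun t => (hf t).1, h₂'' f fun t => (hf t).2⟩⟩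
  | sUnion S _ ih =>
    obtain ⟨s, hs, hυs⟩ := hυ
    obtain ⟨W, h, h', h''⟩ := ih s hs hυs
    exact ⟨W, h, h', fun f hf => ⟨s, hs, h'' f hf⟩⟩

/-- A chord is no longer than its arc. -/
theorem uniformContinuous_circleExp : UniformContinuous Circle.exp := by
  refine LipschitzWith.uniformContinuous (K := 1) (LipschitzWith.of_dist_le_mul fun x y => ?_)
  have e : Complex.exp (x * Complex.I) - Complex.exp (y * Complex.I)
      = Complex.exp (y * Complex.I) * (Complex.exp (Complex.I * ((x - y : ℝ) : ℂ)) - 1) := by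
    rw [mul_sub, ← Complex.exp_add, mul_one]
    push_cast
    ring_nf
  change dist (Circle.exp x : ℂ) (Circle.exp y : ℂ) ≤ _
  rw [dist_eq_norm, Circle.coe_exp, Circle.coe_exp, e, norm_mul,
    Complex.norm_exp_ofReal_mul_I, one_mul, NNReal.coe_one, one_mul, dist_eq_norm]
  exact Real.norm_exp_I_mul_ofReal_sub_one_le

/-- Near `z₀` the argument on the circle has a smooth branch. -/
theorem exists_contMDiffAt_circle_arg (z₀ : Circle) : ∃ f : Circle → ℝ,
    ContMDiffAt (𝓡 1) 𝓘(ℝ, ℝ) ∞ f z₀ ∧ ∀ z, Circle.exp (f z) = z := by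
  -- Rotating z₀ to 1 moves it away from the branch cut of the logarithm.
  refine ⟨fun z => Complex.arg ((z / z₀ : Circle) : ℂ) + Complex.arg z₀, ?_, fun z => ?_⟩
  · have := finrank_real_complex_fact'
    have h1 : ContMDiff (𝓡 1) (𝓡 1) ∞ (fun z : Circle => z / z₀) := by
      simp only [div_eq_mul_inv]
      exact (contMDiff_mul_right (I := 𝓡 1) (n := ω)).of_le le_top
    have h2 : ContMDiff (𝓡 1) 𝓘(ℝ, ℂ) ∞ (fun z : Circle => ((z / z₀ : Circle) : ℂ)) :=
      (contMDiff_coe_sphere (E := ℂ)).comp h1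
    have h3 : ContDiffAt ℝ ∞ (fun w : ℂ => (Complex.log w).im + Complex.arg z₀)
        ((z₀ / z₀ : Circle) : ℂ) := by
      have : ContDiffAt ℝ ∞ Complex.log ((z₀ / z₀ : Circle) : ℂ) := by
        refine (Complex.contDiffAt_log (n := ∞) ?_).restrict_scalars ℝ
        simp
      exact (Complex.imCLM.contDiff.contDiffAt.comp _ this).add contDiffAt_const
    have h4 := h3.contMDiffAt.comp z₀ (h2 z₀)
    simpa only [Function.comp_def, Complex.log_im] using h4
  · rw [Circle.exp_add, Circle.exp_arg, Circle.exp_arg, div_mul_cancel]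

theorem theorem1 {M : Type*} [TopologicalSpace M] [T2Space M] [ChartedSpace E3 M]
    [IsManifold (𝓡 3) ∞ M] (ξ : ContactStructure M) :
    (∀ (a b : ℝ) [Fact (a < b)] (υ : C(Set.Icc a b, M)) (𝒰 : Set C(Set.Icc a b, M)),
      IsOpen[whitneyC0 (Set.Icc a b) M] 𝒰 → υ ∈ 𝒰 →
        ∃ η ∈ 𝒰, ξ.IsLegendrian (𝓡∂ 1) η) ∧
    (∀ (υ : C(Circle, M)) (𝒰 : Set C(Circle, M)),
      IsOpen[whitneyC0 Circle M] 𝒰 → υ ∈ 𝒰 →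
        ∃ η ∈ 𝒰, ξ.IsLegendrian (𝓡 1) η) := by
  refine ⟨fun a b hab υ 𝒰 h𝒰 hυ => ?_, fun υ 𝒰 h𝒰 hυ => ?_⟩
  · obtain ⟨W, hW, hυW, hW𝒰⟩ := exists_graph_subset_of_isOpen_whitneyC0 h𝒰 hυ
    -- Clamping to the interval is 1-Lipschitz and fixes its points, so Γ restricted to it is the
    -- required curve; the length 1 is arbitrary.
    obtain ⟨Γ, hΓ, hΓW, -⟩ := ξ.exists_legendrian_approx (p := Set.projIcc a b hab.out.le)
      (LipschitzWith.projIcc hab.out.le).uniformContinuous υ hW hυW one_pos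
    have hη : ξ.IsLegendrian (𝓡∂ 1) (fun t : Set.Icc a b => Γ t) :=
      ξ.isLegendrian_of_eventuallyEq_comp fun t =>
        ⟨Γ, Subtype.val, hΓ, contMDiff_subtypeVal_Icc t, Filter.EventuallyEq.rfl⟩
    refine ⟨⟨_, hη.smooth.continuous⟩, hW𝒰 _ fun t => ?_, hη⟩
    have := hΓW t
    rwa [Set.projIcc_val] at this
  · obtain ⟨W, hW, hυW, hW𝒰⟩ := exists_graph_subset_of_isOpen_whitneyC0 h𝒰 hυ
    obtain ⟨Γ, hΓ, hΓW, hper⟩ := ξ.exists_legendrian_approx uniformContinuous_circleExp υ hW hυW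
      Real.two_pi_pos
    have hper := hper Circle.periodic_exp
    -- The jump of the argument at -1 is harmless: any smooth local branch differs from it by
    -- multiples of 2π, a period of Γ.
    have hη : ξ.IsLegendrian (𝓡 1) (fun z : Circle => Γ (Complex.arg z)) := by
      refine ξ.isLegendrian_of_eventuallyEq_comp fun z₀ => ?_
      obtain ⟨f, hf, hfe⟩ := exists_contMDiffAt_circle_arg z₀
      refine ⟨Γ, f, hΓ, hf, Filter.Eventually.of_forall fun z => ?_⟩
      obtain ⟨m, hm⟩ := Circle.exp_eq_exp.1 ((Circle.exp_arg z).trans (hfe z).symm)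
      simp only [Function.comp_apply, hm]
      exact hper.int_mul m _
    refine ⟨⟨_, hη.smooth.continuous⟩, hW𝒰 _ fun z => ?_, hη⟩
    have := hΓW (Complex.arg z)
    rwa [Circle.exp_arg] at this
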